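/- Let $N=10$ and, for $k\ge 1$, let $G_k$ be the $N^k\times N^k$ grid: its nodes are the pairs $(i,j)$ with $0\le i,j<N^k$, and two nodes are neighbours iff they agree in one coordinate and differ by exactly $1$ in the other. Some nodes are correct; the others are Byzantine and behave arbitrarily. **Control Zone Protocol (CZP) on a grid.** Communication is asynchronous: each packet sent by a correct node to a neighbour is eventually received, with arbitrary delay. For a node $q$, let $B(q)$ (the border of the control zone with core $\{q\}$) be the set of nodes other than $q$ whose two coordinates each differ by at most $1$ from those of $q$. A correct node $p$ accepts $(s,m)$ if $p=s$ and $p$ has broadcast $m$; or if $p\ne s$ and $p$ has received $(s,m)$ from a neighbour $q$ such that either $q=s$, or $p$ has received an authorization $(s,m,q)$ from a node of $B(q)$. A correct node that accepts $(s,m)$ sends $(s,m)$ to all its neighbours. For each $q$, a correct node of $B(q)$ that accepts $(s,m)$ or has received an authorization $(s,m,q)$ from a node of $B(q)$ sends $(s,m,q)$ to its neighbours in $B(q)$. Byzantine nodes may send anything to their neighbours at any time. A set $S$ of correct nodes is *reliable* if, in every execution and for all $s,r\in S$ and all messages $m$: if $s$ broadcasts $m$, then $r$ eventually accepts $(s,m)$;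 and if $r$ accepts $(s,m)$, then $s$ has broadcast $m$. For a set $C$ of correct nodes of a grid, let $\mathrm{Rel}_{CZP}(C)$ be a reliable node set of largest cardinality for the CZP (a fixed choice for each $C$). **Reliable node sets of $G_k$.** To each node $p=(i,j)$ of $G_k$ associate the macro-node $G(p)$, the $N\times N$ subgrid of $G_{k+1}$ consisting of the nodes $(Ni+a,Nj+b)$, $0\le a,b<N$. An $N\times N$ grid with set $C_0$ of correct nodes is called *correct* if each of its four sides has strictly more than $3N/4$ of its $N$ nodes in $\mathrm{Rel}_{CZP}(C_0)$. For a set $C$ of correct nodes, define $\mathrm{Rel}_1(C)=\mathrm{Rel}_{CZP}(C)$ and $$\mathrm{Rel}_{k+1}(C)=\bigcup_{p\in \mathrm{Rel}_k(C')}\mathrm{Rel}_{CZP}(C\cap G(p)),$$ where $C'$ is the set of nodes $p$ of $G_k$ such that the macro-node $G(p)$, with set $C\cap G(p)$ of correct nodes, is correct. **Theorem.** Suppose that each node of $G_k$ is correct with probability $\mu$, independently of the others, and let $F_k(\mu)=\mathbb E\big[\,|\mathrm{Rel}_k(C)|\,\big]/N^{2k}$ be the expected reliable fraction of $G_k$,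 where $C$ is the random set of correct nodes. If $1-10^{-5}\le\mu\le 1$, then $F_k(\mu)\ge 1-10^{-4}$ for every $k\ge 1$. -/

import Mathlib

namespace ByzantineGrid

/-- The nodes of an `M × M` grid, given by their coordinates. -/
abbrev Node (M : ℕ) : Type := Fin M × Fin M

/-- The `M × M` grid network: two nodes are neighbours iff they agree in one coordinate and
differ by one in the other. -/
def grid (M : ℕ) : SimpleGraph (Node M) where
  Adj p q :=
    (p.1 = q.1 ∧ (p.2.val + 1 = q.2.val ∨ q.2.val + 1 = p.2.val)) ∨
    (p.2 = q.2 ∧ (p.1.val + 1 = q.1.val ∨ q.1.val + 1 = p.1.val))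
  symm := ⟨by
    rintro p q (⟨h, h'⟩ | ⟨h, h'⟩)
    · exact Or.inl ⟨h.symm, h'.symm⟩
    · exact Or.inr ⟨h.symm, h'.symm⟩⟩
  loopless := ⟨by
    rintro p (⟨_, h⟩ | ⟨_, h⟩) <;> omega⟩

/-! ### The Control Zone Protocol -/

section Protocol

/-- A control zone: a core, and a border that surrounds it. -/
structure ControlZone (V : Type) where
  core : Finset V
  border : Finset V

/-- Packets exchanged by the nodes; message contents are natural numbers.
`std s m` means that `s` has broadcast `m`, and `auth s m z` authorizes `(s, m)` to leave the core
of the control zone `z`. -/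
inductive Packet (V : Type) where
  | std (s : V) (m : ℕ)
  | auth (s : V) (m : ℕ) (z : ControlZone V)

/-- A global state: `bcast p` is the set of messages that `p` has broadcast so far, and `rcv p q`
is the set of packets that `p` has received from `q` so far. -/
structure State (V : Type) where
  bcast : V → Set ℕ
  rcv : V → V → Set (Packet V)

variable {V : Type}

/-- `p`, a node of the border of `z`, has received the authorization of `(s, m)` from another node
of this border. -/
def Authorized (c : State V) (p s : V) (m : ℕ) (z : ControlZone V) : Prop :=
  p ∈ z.border ∧ ∃ q ∈ z.border, Packet.auth s m z ∈ c.rcv p q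

/-- `p` accepts `(s, m)`: either `p` is the source, or `p` heard it directly from the
source, or `p` heard it from a neighbour `q` and holds the authorization of `(s, m)` for
each control zone that the message leaves between `q` and `p` and whose core does not contain the
source. -/
def Accepts (ctr : Set (ControlZone V)) (c : State V) (p s : V) (m : ℕ) : Prop :=
  (p = s ∧ m ∈ c.bcast s) ∨
  (p ≠ s ∧ ∃ q, Packet.std s m ∈ c.rcv p q ∧
    (q = s ∨ ∀ z ∈ ctr, q ∈ z.core → p ∈ z.border → s ∉ z.core → Authorized c p s m z))

/-- The packets that the protocol makes a node `q` send to its neighbour `p` in state `c`: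
accepted messages are forwarded to all neighbours; on the border of a control zone,
authorizations are issued for accepted messages and relayed along the border. -/
def Sends (ctr : Set (ControlZone V)) (c : State V) (q p : V) : Packet V → Prop
  | .std s m => Accepts ctr c q s m
  | .auth s m z => z ∈ ctr ∧ q ∈ z.border ∧ p ∈ z.border ∧
      (Accepts ctr c q s m ∨ Authorized c q s m z)

/-- An execution of the protocol on the network `G` when exactly the nodes of `corr` are
correct. In each step, nodes may broadcast new messages, and nodes may receive packets from their
neighbours: anything at all from a Byzantine neighbour, and only packets prescribed by the
protocol from a correct one. The network is asynchronous: a packet sent by a correct node is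
received eventually, but at any time. -/
structure IsExecution (G : SimpleGraph V) (ctr : Set (ControlZone V)) (corr : Finset V)
    (c : ℕ → State V) : Prop where
  bcast_zero : ∀ p, (c 0).bcast p = ∅
  rcv_zero : ∀ p q, (c 0).rcv p q = ∅
  bcast_mono : ∀ n p, (c n).bcast p ⊆ (c (n + 1)).bcast p
  rcv_mono : ∀ n p q, (c n).rcv p q ⊆ (c (n + 1)).rcv p q
  rcv_new : ∀ n p q x, x ∈ (c (n + 1)).rcv p q → x ∉ (c n).rcv p q →
    G.Adj q p ∧ (q ∈ corr → Sends ctr (c n) q p x)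
  delivery : ∀ n p q x, q ∈ corr → G.Adj q p → Sends ctr (c n) q p x →
    ∃ n', x ∈ (c n').rcv p q

/-- A reliable node set: a set of correct nodes such that, in every execution and for all `s`, `r`
in the set, each message that `s` broadcasts is eventually accepted by `r`, and `r`
accepts `(s, m)` only if `s` has broadcast `m`. -/
def IsReliable (G : SimpleGraph V) (ctr : Set (ControlZone V)) (corr S : Finset V) : Prop :=
  S ⊆ corr ∧ ∀ c, IsExecution G ctr corr c → ∀ s ∈ S, ∀ r ∈ S, ∀ m,
    ((∃ n, m ∈ (c n).bcast s) → ∃ n, Accepts ctr (c n) r s m) ∧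
    (∀ n, Accepts ctr (c n) r s m → m ∈ (c n).bcast s)

end Protocol

/-- The control zone of a node `p` of a grid: its core is `p`, its border consists of the (at most
eight) nodes around `p`. -/
def zone {M : ℕ} (p : Node M) : ControlZone (Node M) where
  core := {p}
  border := Finset.univ.filter fun q => q ≠ p ∧
    q.1.val ≤ p.1.val + 1 ∧ p.1.val ≤ q.1.val + 1 ∧
    q.2.val ≤ p.2.val + 1 ∧ p.2.val ≤ q.2.val + 1

/-- `S` is a reliable node set of the Control Zone Protocol on the `M × M` grid, where `corr` is
the set of correct nodes. -/
def IsReliableCZP {M : ℕ} (corr S : Finset (Node M)) : Prop :=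
  IsReliable (grid M) (Set.range zone) corr S

theorem exists_largest_reliable {M : ℕ} (corr : Finset (Node M)) :
    ∃ S, IsReliableCZP corr S ∧ ∀ T, IsReliableCZP corr T → T.card ≤ S.card := by
  classical
  have hne : ((Finset.univ : Finset (Finset (Node M))).filter (IsReliableCZP corr)).Nonempty :=
    ⟨∅, by simp [IsReliableCZP, IsReliable]⟩
  obtain ⟨S, hS, hmax⟩ := Finset.exists_max_image _ Finset.card hne
  exact ⟨S, by simpa using hS, fun T hT => hmax T (by simpa using hT)⟩

/-- `Rel_CZP(corr)`: a largest reliable node set of the Control Zone Protocol on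
the `M × M` grid. -/
noncomputable def relCZP {M : ℕ} (corr : Finset (Node M)) : Finset (Node M) :=
  Classical.choose (exists_largest_reliable corr)

/-! ### The networks `G_k` and their reliable node sets -/

/-- The side length of a macro-node. -/
abbrev N : ℕ := 10

/-- The nodes of the network `G_k`, which is the `N^k × N^k` grid. -/
abbrev GNode (k : ℕ) : Type := Node (N ^ k)

/-- The node of `G_{k+1}` at position `(a, b)` of the macro-node `G(p)`, for `p` in `G_k`: if
`p = (i, j)`, this is `(N i + a, N j + b)`. -/
def inMacro {k : ℕ} (p : GNode k) (a : Node N) : GNode (k + 1) :=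
  have bound (x : Fin (N ^ k)) (y : Fin N) : N * x.val + y.val < N ^ (k + 1) := by
    have hx := x.isLt
    have hy := y.isLt
    rw [pow_succ]
    simp only [N] at *
    omega
  (⟨N * p.1.val + a.1.val, bound p.1 a.1⟩, ⟨N * p.2.val + a.2.val, bound p.2 a.2⟩)

/-- A macro-node with set `corr` of correct nodes is correct if each of its four sides has strictly
more than `3N/4` nodes in `Rel_CZP(corr)`. -/
def CorrectMacro (corr : Finset (Node N)) : Prop :=
  3 * N < 4 * ((relCZP corr).filter fun a => a.1.val = 0).card ∧
  3 * N < 4 * ((relCZP corr).filter fun a => a.1.val = N - 1).card ∧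
  3 * N < 4 * ((relCZP corr).filter fun a => a.2.val = 0).card ∧
  3 * N < 4 * ((relCZP corr).filter fun a => a.2.val = N - 1).card

/-- `Corr(p)`: the correct nodes of the macro-node `G(p)`. -/
def corrIn {k : ℕ} (corr : Finset (GNode (k + 1))) (p : GNode k) : Finset (Node N) :=
  Finset.univ.filter fun a => inMacro p a ∈ corr

open Classical in
/-- `Corr'`: the nodes `p` of `G_k` such that the macro-node `G(p)` is correct. -/
noncomputable def corrMacro {k : ℕ} (corr : Finset (GNode (k + 1))) : Finset (GNode k) :=
  Finset.univ.filter fun p => CorrectMacro (corrIn corr p)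

/-- `Rel_k(corr)`, for `k ≥ 1`: `Rel_1` is `Rel_CZP`, and `Rel_{k+1}(corr)` is the union of the
sets `Rel_CZP(Corr(p))`, placed in `G(p)`, over all `p ∈ Rel_k(Corr')`. (The value at `k = 0` is
irrelevant.) -/
noncomputable def Rel : (k : ℕ) → Finset (GNode k) → Finset (GNode k)
  | 0, _ => ∅
  | 1, corr => relCZP corr
  | k + 2, corr =>
      (Rel (k + 1) (corrMacro corr)).biUnion fun p =>
        (relCZP (corrIn corr p)).image (inMacro p)

/-- The expectation of `X`, a function of the random set of correct nodes, when each node is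
correct with probability `μ`, independently of the others. -/
noncomputable def expectation {V : Type} [Fintype V] (μ : ℝ) (X : Finset V → ℝ) : ℝ :=
  ∑ corr : Finset V, μ ^ corr.card * (1 - μ) ^ (Fintype.card V - corr.card) * X corr

/-- `F_k(μ)`: the expected reliable fraction of `G_k`. -/
noncomputable def F (k : ℕ) (μ : ℝ) : ℝ :=
  expectation μ fun corr : Finset (GNode k) =>
    ((Rel k corr).card : ℝ) / (Fintype.card (GNode k) : ℝ)

end ByzantineGrid

/-! The failure bound is quadratic at each change of scale, so the losses add up to a convergent
series. With `x = 1 - μ`, a macro-node that has at most one Byzantine node is correct, hence it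
fails with probability at most `99² x²`, which is below `x / 10` for `x ≤ 10⁻⁵`. The set of correct
macro-nodes is again an independent random set, now with parameter `macroProb μ`
(`expectation_good_blocks`). Passing from one level to the next costs at most the expected loss
inside a single macro-node, about `4 x` (`F_add_two_ge`, `expectedLoss_le`). This gives `1 - F ≤ 5
x` at every level (`one_sub_F_le`).

The protocol enters only through the `10 × 10` grid with at most one Byzantine node `b`. Safety: the
border of the zone of `b` is correct, so nothing forged leaves it (`bcast_of_accepts`). Liveness: a
border minus one node is still connected, so authorizations get around `b`, and acceptance spreads
over the interior and then to the sides (`isReliable_exposedNodes`). At most four nodes are lost.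
Since `Rel_CZP` is an arbitrary largest reliable set, its sides are controlled by nodes that no
large reliable set can contain (`card_side_relCZP_compl_singleton`). -/

namespace ByzantineGrid

/-! ### Independent random sets of correct nodes -/

section Expectation

/-- The probability that `corr` is the set of correct nodes. -/
noncomputable def weight {V : Type} [Fintype V] (μ : ℝ) (corr : Finset V) : ℝ :=
  μ ^ corr.card * (1 - μ) ^ (Fintype.card V - corr.card)

variable {V P A : Type} [Fintype V] [Fintype P] [Fintype A]

theorem expectation_eq_sum_weight (μ : ℝ) (X : Finset V → ℝ) :
    expectation μ X = ∑ corr, weight μ corr * X corr := rfl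

theorem weight_nonneg {μ : ℝ} (h0 : 0 ≤ μ) (h1 : μ ≤ 1) (corr : Finset V) :
    0 ≤ weight μ corr :=
  mul_nonneg (pow_nonneg h0 _) (pow_nonneg (sub_nonneg.2 h1) _)

open Classical in
theorem weight_eq_prod (μ : ℝ) (corr : Finset V) :
    weight μ corr = ∏ v, if v ∈ corr then μ else 1 - μ := by
  rw [Finset.prod_ite, Finset.prod_const, Finset.prod_const, weight]
  congr 3
  · simp
  · rw [← Finset.card_compl]
    congr 1
    ext v
    simp

theorem sum_weight_mul_card (μ : ℝ) (f : ℕ → ℝ) :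
    expectation μ (fun corr : Finset V => f corr.card) =
      ∑ j ∈ Finset.range (Fintype.card V + 1),
        (Fintype.card V).choose j * (μ ^ j * (1 - μ) ^ (Fintype.card V - j) * f j) := by
  have h := Finset.sum_powerset_apply_card
    (fun j => μ ^ j * (1 - μ) ^ (Fintype.card V - j) * f j) (x := (Finset.univ : Finset V))
  rw [Finset.powerset_univ, Finset.card_univ] at h
  simp only [expectation, h, nsmul_eq_mul]

theorem sum_weight (μ : ℝ) : ∑ corr : Finset V, weight μ corr = 1 := by
  have h := sum_weight_mul_card (V := V) μ (fun _ => 1)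
  simp only [expectation_eq_sum_weight, mul_one] at h
  rw [h]
  have h2 := add_pow μ (1 - μ) (Fintype.card V)
  rw [add_sub_cancel, one_pow] at h2
  exact (Finset.sum_congr rfl fun j _ => by ring).trans h2.symm

theorem expectation_mono {μ : ℝ} (h0 : 0 ≤ μ) (h1 : μ ≤ 1) {X Y : Finset V → ℝ}
    (h : ∀ corr, X corr ≤ Y corr) : expectation μ X ≤ expectation μ Y :=
  Finset.sum_le_sum fun corr _ => mul_le_mul_of_nonneg_left (h corr) (weight_nonneg h0 h1 corr)

theorem expectation_const (μ a : ℝ) : expectation μ (fun _ : Finset V => a) = a := by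
  rw [expectation_eq_sum_weight, ← Finset.sum_mul, sum_weight, one_mul]

theorem expectation_add (μ : ℝ) (X Y : Finset V → ℝ) :
    expectation μ (fun c => X c + Y c) = expectation μ X + expectation μ Y := by
  simp only [expectation, mul_add, Finset.sum_add_distrib]

theorem expectation_sub (μ : ℝ) (X Y : Finset V → ℝ) :
    expectation μ (fun c => X c - Y c) = expectation μ X - expectation μ Y := by
  simp only [expectation, mul_sub, Finset.sum_sub_distrib]

theorem expectation_const_mul (μ a : ℝ) (X : Finset V → ℝ) :
    expectation μ (fun c => a * X c) = a * expectation μ X := by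
  simp only [expectation, Finset.mul_sum]
  exact Finset.sum_congr rfl fun c _ => by ring

theorem expectation_sum {ι : Type} (t : Finset ι) (μ : ℝ) (X : ι → Finset V → ℝ) :
    expectation μ (fun c => ∑ i ∈ t, X i c) = ∑ i ∈ t, expectation μ (X i) := by
  simp only [expectation, Finset.mul_sum]
  exact Finset.sum_comm

open Classical in
/-- A random set of nodes that are partitioned into blocks of the same shape is a family of
independent random subsets of the blocks. -/
theorem expectation_blocks (e : P × A ≃ V) (μ : ℝ) (X : (P → Finset A) → ℝ) :
    expectation μ (fun corr : Finset V => X fun p => Finset.univ.filter fun a => e (p, a) ∈ corr) =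
      ∑ f : P → Finset A, (∏ p, weight μ (f p)) * X f := by
  rw [expectation_eq_sum_weight]
  refine Fintype.sum_bijective
    (fun (corr : Finset V) p => Finset.univ.filter fun a => e (p, a) ∈ corr) ⟨?_, ?_⟩ _ _ ?_
  · intro C D h
    ext v
    have := congrArg (fun t => (e.symm v).2 ∈ t) (congrFun h (e.symm v).1)
    simpa using this
  · intro f
    refine ⟨Finset.univ.filter fun v => (e.symm v).2 ∈ f (e.symm v).1, ?_⟩
    ext p a
    simp
  · intro C
    congr 1
    rw [weight_eq_prod, ← Equiv.prod_comp e, Fintype.prod_prod_type]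
    refine Finset.prod_congr rfl fun p _ => ?_
    rw [weight_eq_prod]
    simp

open Classical in
theorem expectation_block (e : P × A ≃ V) (μ : ℝ) (p : P) (g : Finset A → ℝ) :
    expectation μ (fun corr : Finset V => g (Finset.univ.filter fun a => e (p, a) ∈ corr)) =
      expectation μ g := by
  rw [expectation_blocks e μ (fun f => g (f p))]
  -- Expanding a product of sums over the blocks; every factor other than that of `p` sums to one.
  have h := Finset.prod_univ_sum (fun _ : P => (Finset.univ : Finset (Finset A)))
    (fun p' a => weight μ a * if p' = p then g a else 1)
  rw [Fintype.piFinset_univ] at h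
  calc _ = ∑ f : P → Finset A, ∏ p', (weight μ (f p') * if p' = p then g (f p') else 1) := by
        refine Finset.sum_congr rfl fun f _ => ?_
        rw [Finset.prod_mul_distrib, Finset.prod_ite_eq']
        simp
    _ = _ := by
        rw [← h, Finset.prod_eq_single p]
        · simp [expectation_eq_sum_weight]
        · intro b _ hb
          simp [hb, sum_weight]
        · simp

open Classical in
/-- If each block satisfies `Q` with probability `ν`, then the set of blocks satisfying `Q` is a
random set with parameter `ν`. -/
theorem expectation_good_blocks (e : P × A ≃ V) (μ : ℝ) (Q : Finset A → Prop)
    (X : Finset P → ℝ) :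
    expectation μ (fun corr : Finset V => X (Finset.univ.filter fun p =>
        Q (Finset.univ.filter fun a => e (p, a) ∈ corr))) =
      expectation (expectation μ fun c => if Q c then 1 else 0) X := by
  set ν := expectation μ fun c => if Q c then (1 : ℝ) else 0 with hν
  have hν1 : ∑ c with Q c, weight μ c = ν := by
    rw [hν, expectation_eq_sum_weight, Finset.sum_filter]
    exact Finset.sum_congr rfl fun c _ => by split_ifs <;> simp
  have hν2 : ∑ c with ¬ Q c, weight μ c = 1 - ν := by
    rw [← hν1, ← sum_weight (V := A) μ, eq_sub_iff_add_eq', Finset.sum_filter_add_sum_filter_not]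
  rw [expectation_blocks e μ (fun f => X (Finset.univ.filter fun p => Q (f p))),
    expectation_eq_sum_weight]
  -- Families of blocks are grouped by the set `D` of their good blocks; each fibre is a product
  -- set, so its weight factors over the blocks.
  rw [← Finset.sum_fiberwise (s := Finset.univ)
    (g := fun f : P → Finset A => Finset.univ.filter fun p => Q (f p))]
  refine Finset.sum_congr rfl fun D _ => ?_
  have h := Finset.prod_univ_sum (fun p : P => Finset.univ.filter fun c : Finset A => Q c ↔ p ∈ D)
    (fun _ a => weight μ a)
  rw [weight_eq_prod]
  have h3 : ∀ p : P, (∑ c with (Q c ↔ p ∈ D), weight μ c) = if p ∈ D then ν else 1 - ν := by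
    intro p
    split_ifs with hp
    · simpa [hp] using hν1
    · simpa [hp] using hν2
  rw [← Finset.prod_congr rfl fun p _ => h3 p, h, Finset.sum_mul]
  refine Finset.sum_congr ?_ ?_
  · ext f
    simp [Finset.ext_iff]
  · intro f hf
    have : (Finset.univ.filter fun p => Q (f p)) = D := by
      ext p
      have := Fintype.mem_piFinset.1 hf p
      simpa using this
    rw [this]

/-- An upper bound on the probability of at least two failures among `n + 1` nodes. -/
theorem expectation_two_failures {n : ℕ} (hV : Fintype.card V = n + 1) {μ : ℝ} (h0 : 0 ≤ μ)
    (h1 : μ ≤ 1) :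
    expectation μ (fun corr : Finset V => if corr.card < n then 1 else 0) ≤
      n ^ 2 * (1 - μ) ^ 2 := by
  have hs := sum_weight_mul_card (V := V) μ (fun j => if j < n then 1 else 0)
  have h2 := add_pow μ (1 - μ) (n + 1)
  rw [add_sub_cancel, one_pow, Finset.sum_range_succ, Finset.sum_range_succ] at h2
  rw [hs, hV, Finset.sum_range_succ, Finset.sum_range_succ]
  have h3 : ∑ x ∈ Finset.range n, ((n + 1).choose x : ℝ) *
      (μ ^ x * (1 - μ) ^ (n + 1 - x) * if x < n then 1 else 0) =
      ∑ x ∈ Finset.range n, μ ^ x * (1 - μ) ^ (n + 1 - x) * ((n + 1).choose x : ℝ) := by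
    refine Finset.sum_congr rfl fun x hx => ?_
    rw [if_pos (Finset.mem_range.1 hx)]
    ring
  rw [h3]
  -- With `x = 1 - μ`, the probability of at most one failure is `μ ^ n * (1 + n * x)`; Bernoulli
  -- bounds it below by `(1 - n * x) * (1 + n * x)`.
  have hb := one_add_mul_le_pow (a := μ - 1) (by linarith) n
  rw [add_sub_cancel] at hb
  simp only [Nat.add_sub_cancel_left, Nat.sub_self, pow_one, pow_zero,
    Nat.choose_self, Nat.choose_succ_self_right, lt_irrefl, if_false, mul_zero, add_zero,
    not_lt_of_ge (Nat.le_succ n)] at h2 ⊢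
  push_cast at h2
  have h4 : (1 + n * (μ - 1)) * (1 + n * (1 - μ)) ≤ μ ^ n * (1 + n * (1 - μ)) :=
    mul_le_mul_of_nonneg_right hb (by
      have : (0 : ℝ) ≤ n * (1 - μ) := mul_nonneg (Nat.cast_nonneg n) (by linarith)
      linarith)
  rw [pow_succ] at h2
  nlinarith [h2, h4]

theorem expectation_one_failure {n : ℕ} (hV : Fintype.card V = n + 1) {μ : ℝ} (h0 : 0 ≤ μ)
    (h1 : μ ≤ 1) :
    expectation μ (fun corr : Finset V => if corr.card = n then 1 else 0) ≤
      (n + 1) * (1 - μ) := by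
  rw [sum_weight_mul_card (V := V) μ (fun j => if j = n then 1 else 0), hV]
  rw [Finset.sum_eq_single n]
  · simp only [Nat.choose_succ_self_right, Nat.add_sub_cancel_left, if_true, pow_one, mul_one]
    push_cast
    have : μ ^ n ≤ 1 := pow_le_one₀ h0 h1
    refine mul_le_mul_of_nonneg_left ?_ (by positivity)
    nlinarith
  · intro j _ hj
    simp [hj]
  · intro h
    simp at h

end Expectation


/-! ### Executions of the protocol -/

section Executions

variable {V : Type} {G : SimpleGraph V} {ctr : Set (ControlZone V)} {corr : Finset V}
  {c : ℕ → State V}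

theorem IsExecution.rcv_subset (h : IsExecution G ctr corr c) {n n' : ℕ} (hn : n ≤ n') (p q : V) :
    (c n).rcv p q ⊆ (c n').rcv p q :=
  monotone_nat_of_le_succ (f := fun n => (c n).rcv p q) (fun n => h.rcv_mono n p q) hn

theorem IsExecution.adj_of_rcv (h : IsExecution G ctr corr c) {n : ℕ} {p q : V} {x : Packet V}
    (hx : x ∈ (c n).rcv p q) : G.Adj q p := by
  induction n with
  | zero => simp [h.rcv_zero] at hx
  | succ n ih =>
    by_cases hx' : x ∈ (c n).rcv p q
    · exact ih hx'
    · exact (h.rcv_new n p q x hx hx').1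

theorem IsExecution.authorized_mono (h : IsExecution G ctr corr c) {n n' : ℕ} (hn : n ≤ n')
    {p s : V} {m : ℕ} {z : ControlZone V} (ha : Authorized (c n) p s m z) :
    Authorized (c n') p s m z :=
  ⟨ha.1, ha.2.imp fun q hq => ⟨hq.1, h.rcv_subset hn p q hq.2⟩⟩

/-- The synchronous execution in which `s` broadcasts `m` and the Byzantine nodes are silent. -/
def silentExecution (G : SimpleGraph V) (ctr : Set (ControlZone V)) (corr : Finset V) (s : V)
    (m : ℕ) : ℕ → State V
  | 0 => ⟨fun _ => ∅, fun _ _ => ∅⟩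
  | n + 1 =>
    { bcast := fun p => {x | p = s ∧ x = m}
      rcv := fun p q => {x | x ∈ (silentExecution G ctr corr s m n).rcv p q ∨
        (q ∈ corr ∧ G.Adj q p ∧ Sends ctr (silentExecution G ctr corr s m n) q p x)} }

theorem isExecution_silentExecution (s : V) (m : ℕ) :
    IsExecution G ctr corr (silentExecution G ctr corr s m) where
  bcast_zero _ := rfl
  rcv_zero _ _ := rfl
  bcast_mono n p := by
    cases n with
    | zero => exact Set.empty_subset _
    | succ n => exact subset_rfl
  rcv_mono n p q := fun x hx => Or.inl hx
  rcv_new n p q x hx hx' := by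
    rcases hx with hx | hx
    · exact absurd hx hx'
    · exact ⟨hx.2.1, fun _ => hx.2.2⟩
  delivery n p q x hq hpq hx := ⟨n + 1, Or.inr ⟨hq, hpq, hx⟩⟩

theorem mem_corr_of_rcv_silentExecution {s : V} {m n : ℕ} {p q : V} {x : Packet V}
    (hx : x ∈ (silentExecution G ctr corr s m n).rcv p q) : q ∈ corr := by
  induction n with
  | zero => exact absurd hx (Set.notMem_empty x)
  | succ n ih =>
    rcases hx with hx | hx
    · exact ih hx
    · exact hx.1

/-- `p` eventually accepts `(s, m)`. -/
def Reached (ctr : Set (ControlZone V)) (c : ℕ → State V) (s : V) (m : ℕ) (p : V) : Prop :=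
  ∃ n, Accepts ctr (c n) p s m

end Executions

/-! ### Safety and elementary deliveries on the grid -/

section Grid

variable {M : ℕ}

theorem mem_border_of_adj {p q : Node M} (h : (grid M).Adj q p) : p ∈ (zone q).border := by
  simp only [zone, Finset.mem_filter, Finset.mem_univ, true_and]
  refine ⟨h.ne', ?_⟩
  rcases h with ⟨h1, h2⟩ | ⟨h1, h2⟩
  · rw [h1]; omega
  · rw [h1]; omega

/-- Cores are singletons, so a packet from a neighbour `q` leaves exactly one zone, that of `q`. -/
theorem accepts_zone_iff {c : State (Node M)} {p s : Node M} {m : ℕ}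
    (hadj : ∀ p q x, x ∈ c.rcv p q → (grid M).Adj q p) :
    Accepts (Set.range zone) c p s m ↔ (p = s ∧ m ∈ c.bcast s) ∨
      (p ≠ s ∧ ∃ q, Packet.std s m ∈ c.rcv p q ∧ (q = s ∨ Authorized c p s m (zone q))) := by
  refine or_congr_right (and_congr_right fun _ => exists_congr fun q => and_congr_right fun hq => ?_)
  constructor
  · rintro (h | h)
    · exact Or.inl h
    · by_cases hqs : q = s
      · exact Or.inl hqs
      · refine Or.inr (h _ ⟨q, rfl⟩ ?_ (mem_border_of_adj (hadj _ _ _ hq)) ?_)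
        · simp [zone]
        · simpa [zone] using Ne.symm hqs
  · rintro (h | h)
    · exact Or.inl h
    · refine Or.inr ?_
      rintro _ ⟨q', rfl⟩ hq' - -
      have : q = q' := by simpa [zone] using hq'
      exact this ▸ h

/-- If the control zones of the Byzantine nodes have correct borders, then no
correct node is ever impersonated. -/
theorem bcast_of_accepts {corr : Finset (Node M)} {c : ℕ → State (Node M)}
    (h : IsExecution (grid M) (Set.range zone) corr c)
    (hb : ∀ q ∉ corr, ∀ x ∈ (zone q).border, x ∈ corr) {s : Node M} (hs : s ∈ corr) {m : ℕ} (n : ℕ) :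
    ∀ p, Accepts (Set.range zone) (c n) p s m → m ∈ (c n).bcast s := by
  -- Acceptance, authorization around Byzantine nodes and packets from correct nodes depend on one
  -- another, so the three invariants go through the induction together.
  suffices H : ∀ n, (∀ p, Accepts (Set.range zone) (c n) p s m → m ∈ (c n).bcast s) ∧
      (∀ p, ∀ q ∉ corr, Authorized (c n) p s m (zone q) → m ∈ (c n).bcast s) ∧
      (∀ p, ∀ q ∈ corr, Packet.std s m ∈ (c n).rcv p q → m ∈ (c n).bcast s) from (H n).1
  have key : ∀ n, (∀ p, ∀ q ∉ corr, Authorized (c n) p s m (zone q) → m ∈ (c n).bcast s) →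
      (∀ p, ∀ q ∈ corr, Packet.std s m ∈ (c n).rcv p q → m ∈ (c n).bcast s) →
      ∀ p, Accepts (Set.range zone) (c n) p s m → m ∈ (c n).bcast s := by
    intro n h2 h3 p hp
    rw [accepts_zone_iff fun p q x => h.adj_of_rcv] at hp
    rcases hp with ⟨_, hm⟩ | ⟨_, q, hq, hqs⟩
    · exact hm
    · by_cases hqc : q ∈ corr
      · exact h3 p q hqc hq
      · rcases hqs with rfl | hqs
        · exact absurd hs hqc
        · exact h2 p q hqc hqs
  intro n
  induction n with
  | zero =>
    have h2 : ∀ p, ∀ q ∉ corr, Authorized (c 0) p s m (zone q) → m ∈ (c 0).bcast s := by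
      rintro p q - ⟨-, x, -, hx⟩
      simp [h.rcv_zero] at hx
    have h3 : ∀ p, ∀ q ∈ corr, Packet.std s m ∈ (c 0).rcv p q → m ∈ (c 0).bcast s := by
      intro p q _ hx
      simp [h.rcv_zero] at hx
    exact ⟨key 0 h2 h3, h2, h3⟩
  | succ n ih =>
    obtain ⟨ih1, ih2, ih3⟩ := ih
    have h2 : ∀ p, ∀ q ∉ corr, Authorized (c (n + 1)) p s m (zone q) →
        m ∈ (c (n + 1)).bcast s := by
      rintro p q hq ⟨hp, x, hx, hxp⟩
      refine h.bcast_mono n s ?_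
      by_cases hxp' : Packet.auth s m (zone q) ∈ (c n).rcv p x
      · exact ih2 p q hq ⟨hp, x, hx, hxp'⟩
      · obtain ⟨-, -, -, ha⟩ := (h.rcv_new n p x _ hxp hxp').2 (hb q hq x hx)
        exact ha.elim (ih1 x) (ih2 x q hq)
    have h3 : ∀ p, ∀ q ∈ corr, Packet.std s m ∈ (c (n + 1)).rcv p q →
        m ∈ (c (n + 1)).bcast s := by
      intro p q hq hx
      refine h.bcast_mono n s ?_
      by_cases hx' : Packet.std s m ∈ (c n).rcv p q
      · exact ih3 p q hq hx'
      · exact ih1 q ((h.rcv_new n p q _ hx hx').2 hq)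
    exact ⟨key _ h2 h3, h2, h3⟩

section Liveness

variable {corr : Finset (Node M)} {c : ℕ → State (Node M)} {s : Node M} {m : ℕ}

theorem reached_of_adj_source (h : IsExecution (grid M) (Set.range zone) corr c) (hs : s ∈ corr)
    (hr : Reached (Set.range zone) c s m s) {p : Node M} (hp : (grid M).Adj s p) :
    Reached (Set.range zone) c s m p := by
  obtain ⟨n, hn⟩ := hr
  obtain ⟨n', hn'⟩ := h.delivery n p s (.std s m) hs hp hn
  exact ⟨n', Or.inr ⟨hp.ne', s, hn', Or.inl rfl⟩⟩

theorem authorized_of_adj (h : IsExecution (grid M) (Set.range zone) corr c) {q x y : Node M}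
    (hx : x ∈ corr) (hxq : x ∈ (zone q).border) (hyq : y ∈ (zone q).border)
    (hxy : (grid M).Adj x y)
    (ha : Reached (Set.range zone) c s m x ∨ ∃ n, Authorized (c n) x s m (zone q)) :
    ∃ n, Authorized (c n) y s m (zone q) := by
  have : ∃ n, Sends (Set.range zone) (c n) x y (.auth s m (zone q)) := by
    rcases ha with ⟨n, ha⟩ | ⟨n, ha⟩
    · exact ⟨n, ⟨q, rfl⟩, hxq, hyq, Or.inl ha⟩
    · exact ⟨n, ⟨q, rfl⟩, hxq, hyq, Or.inr ha⟩
  obtain ⟨n, hn⟩ := this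
  obtain ⟨n', hn'⟩ := h.delivery n y x _ hx hxy hn
  exact ⟨n', hyq, x, hxq, hn'⟩

theorem reached_of_authorized (h : IsExecution (grid M) (Set.range zone) corr c)
    (hs : Reached (Set.range zone) c s m s) {q p : Node M} (hq : q ∈ corr)
    (hqr : Reached (Set.range zone) c s m q) (hqp : (grid M).Adj q p)
    (ha : ∃ n, Authorized (c n) p s m (zone q)) : Reached (Set.range zone) c s m p := by
  by_cases hps : p = s
  · exact hps ▸ hs
  obtain ⟨n, hn⟩ := hqr
  obtain ⟨n', hn'⟩ := h.delivery n p q (.std s m) hq hqp hn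
  obtain ⟨k, hk⟩ := ha
  refine ⟨max n' k, (accepts_zone_iff fun p q x => h.adj_of_rcv).2 (Or.inr ⟨hps, q, ?_, Or.inr ?_⟩)⟩
  · exact h.rcv_subset (le_max_left _ _) _ _ hn'
  · exact h.authorized_mono (le_max_right _ _) hk

end Liveness

end Grid


/-! ### Spreading of acceptance around one Byzantine node -/

section Spread

theorem iff_of_iff_succ {P : ℕ → Prop} {lo hi : ℕ}
    (h : ∀ k, lo ≤ k → k < hi → (P k ↔ P (k + 1))) {x y : ℕ} (hx : lo ≤ x) (hx' : x ≤ hi)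
    (hy : lo ≤ y) (hy' : y ≤ hi) : P x ↔ P y := by
  have key : ∀ z, lo ≤ z → z ≤ hi → (P lo ↔ P z) := by
    intro z hz
    induction z, hz using Nat.le_induction with
    | base => exact fun _ => Iff.rfl
    | succ k hk ih => exact fun hk' => (ih (by omega)).trans (h k hk (by omega))
  exact (key x hx hx').symm.trans (key y hy hy')

/-- A cycle of length eight with one vertex removed is connected. -/
theorem ring_spread {P g : Fin 8 → Prop} (step : ∀ k, g k → P k → P (k + 1) ∧ P (k - 1))
    (uniq : ∀ k l, ¬ g k → ¬ g l → k = l) {x : Fin 8} (hgx : g x) (hx : P x) (y : Fin 8) :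
    P y := by
  have arith : ∀ b : Fin 8, ∀ k < 7, 1 ≤ k → b + Fin.ofNat 8 k + 1 = b + Fin.ofNat 8 (k + 1) ∧
      b + Fin.ofNat 8 (k + 1) - 1 = b + Fin.ofNat 8 k ∧
      b + Fin.ofNat 8 k ≠ b ∧ b + Fin.ofNat 8 (k + 1) ≠ b := by decide
  have arith' : ∀ b z : Fin 8, z ≠ b →
      1 ≤ (z - b).val ∧ z = b + Fin.ofNat 8 (z - b).val := by decide
  obtain ⟨b, hb⟩ : ∃ b, ¬ g b ∨ ∀ k, g k := by
    by_cases h : ∀ k, g k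
    · exact ⟨0, Or.inr h⟩
    · push Not at h
      exact h.imp fun b hb => Or.inl hb
  have hgood : ∀ k, k ≠ b → g k := fun k hk => by
    by_contra hk'
    rcases hb with hb | hb
    · exact hk (uniq k b hk' hb)
    · exact hk' (hb k)
  have hline : ∀ k, 1 ≤ k → k < 7 → (P (b + Fin.ofNat 8 k) ↔ P (b + Fin.ofNat 8 (k + 1))) := by
    intro k h1 h7
    obtain ⟨e1, e2, n1, n2⟩ := arith b k h7 h1
    exact ⟨fun h => e1 ▸ (step _ (hgood _ n1) h).1, fun h => e2 ▸ (step _ (hgood _ n2) h).2⟩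
  have hpos : ∀ z : Fin 8, z ≠ b → ∃ k, 1 ≤ k ∧ k ≤ 7 ∧ z = b + Fin.ofNat 8 k := by
    intro z hz
    obtain ⟨h1, h2⟩ := arith' b z hz
    exact ⟨(z - b).val, h1, by omega, h2⟩
  have hne : ∀ z w : Fin 8, z ≠ b → w ≠ b → P z → P w := by
    intro z w hz hw hPz
    obtain ⟨k, hk1, hk7, rfl⟩ := hpos z hz
    obtain ⟨l, hl1, hl7, rfl⟩ := hpos w hw
    exact (iff_of_iff_succ (P := fun k => P (b + Fin.ofNat 8 k)) hline hk1 hk7 hl1 hl7).1 hPz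
  have hb1 : b + 1 ≠ b := (arith b 1 (by decide) le_rfl).2.2.1
  by_cases hxb : x = b
  · by_cases hyb : y = b
    · rwa [hyb, ← hxb]
    · subst hxb
      exact hne _ _ hb1 hyb (step x hgx hx).1
  · by_cases hyb : y = b
    · subst hyb
      have := (step (y + 1) (hgood _ hb1) (hne _ _ hxb hb1 hx)).2
      rwa [add_sub_cancel_right] at this
    · exact hne _ _ hxb hyb hx

/-- Adjacency of grid points, in coordinates. -/
def CoordAdj (i j i' j' : ℕ) : Prop :=
  (i = i' ∧ (j + 1 = j' ∨ j' + 1 = j)) ∨ (j = j' ∧ (i + 1 = i' ∨ i' + 1 = i))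

/-- `(i, j)` lies on the border of the control zone of `(a, b)`, in coordinates. -/
def CoordBorder (a b i j : ℕ) : Prop :=
  ¬ (i = a ∧ j = b) ∧ i ≤ a + 1 ∧ a ≤ i + 1 ∧ j ≤ b + 1 ∧ b ≤ j + 1

/-- What the protocol guarantees on the `10 × 10` grid with at most one
Byzantine node: `G` describes the correct nodes, `A` the accepting ones, and `R a b` those
authorized for the control zone of `(a, b)`. -/
structure Spreading (G A : ℕ → ℕ → Prop) (R : ℕ → ℕ → ℕ → ℕ → Prop) : Prop where
  lt : ∀ {i j}, G i j → i < 10 ∧ j < 10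
  uniq : ∀ {i j i' j'}, i < 10 → j < 10 → i' < 10 → j' < 10 → ¬ G i j → ¬ G i' j' →
    i = i' ∧ j = j'
  auth : ∀ {a b i j i' j'}, a < 10 → b < 10 → i' < 10 → j' < 10 → G i j →
    CoordBorder a b i j → CoordBorder a b i' j' → CoordAdj i j i' j' → A i j ∨ R a b i j →
    R a b i' j'
  accept : ∀ {a b i j}, i < 10 → j < 10 → G a b → A a b → CoordAdj a b i j → R a b i j → A i j

variable {G A : ℕ → ℕ → Prop} {R : ℕ → ℕ → ℕ → ℕ → Prop}

/-- The border of an interior node is an 8-cycle with at most one bad vertex, so an authorization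
issued by one accepting neighbour reaches all the others, which then accept from the centre. -/
theorem Spreading.accept_of_interior (h : Spreading G A R) {i j : ℕ} (hi : i < 8) (hj : j < 8)
    (hG : G (i + 1) (j + 1)) (hA : A (i + 1) (j + 1)) {x y x' y' : ℕ}
    (hx : CoordAdj (i + 1) (j + 1) x y) (hGx : G x y) (hAx : A x y)
    (hx' : CoordAdj (i + 1) (j + 1) x' y') (hGx' : G x' y') : A x' y' := by
  -- The border in cyclic order; the odd indices are the neighbours of the centre.
  let r : Fin 8 → ℕ × ℕ := ![(i, j), (i, j + 1), (i, j + 2), (i + 1, j + 2), (i + 2, j + 2),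
    (i + 2, j + 1), (i + 2, j), (i + 1, j)]
  have hr : ∀ {x y}, CoordAdj (i + 1) (j + 1) x y → ∃ k, r k = (x, y) := by
    rintro x y (⟨h1, h2 | h2⟩ | ⟨h1, h2 | h2⟩)
    · exact ⟨3, by simp [r]; omega⟩
    · exact ⟨7, by simp [r]; omega⟩
    · exact ⟨5, by simp [r]; omega⟩
    · exact ⟨1, by simp [r]; omega⟩
  have hlt : ∀ k, (r k).1 < 10 ∧ (r k).2 < 10 := by
    intro k; fin_cases k <;> simp [r] <;> omega
  have hbd : ∀ k, CoordBorder (i + 1) (j + 1) (r k).1 (r k).2 := by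
    intro k; fin_cases k <;> simp [r, CoordBorder] <;> omega
  have hadj : ∀ k, CoordAdj (r k).1 (r k).2 (r (k + 1)).1 (r (k + 1)).2 := by
    intro k; fin_cases k <;> simp [r, CoordAdj]
  have hadj' : ∀ k, CoordAdj (r k).1 (r k).2 (r (k - 1)).1 (r (k - 1)).2 := by
    intro k
    have := hadj (k - 1)
    rw [sub_add_cancel] at this
    unfold CoordAdj at this ⊢
    omega
  have hinj : ∀ k l, (r k).1 = (r l).1 ∧ (r k).2 = (r l).2 → k = l := by
    intro k l
    fin_cases k <;> fin_cases l <;> simp [r]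
  obtain ⟨k, hk⟩ := hr hx
  obtain ⟨l, hl⟩ := hr hx'
  have key := ring_spread (P := fun k => A (r k).1 (r k).2 ∨ R (i + 1) (j + 1) (r k).1 (r k).2)
    (g := fun k => G (r k).1 (r k).2)
    (fun k hg hP => ⟨Or.inr (h.auth (by omega) (by omega) (hlt _).1 (hlt _).2 hg (hbd _) (hbd _)
      (hadj k) hP), Or.inr (h.auth (by omega) (by omega) (hlt _).1 (hlt _).2 hg (hbd _) (hbd _)
      (hadj' k) hP)⟩)
    (fun k l hk hl => hinj k l (h.uniq (hlt k).1 (hlt k).2 (hlt l).1 (hlt l).2 hk hl))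
    (x := k) (by simpa [hk] using hGx) (by simpa [hk] using Or.inl hAx) l
  rw [hl] at key
  exact key.elim id (h.accept (h.lt hGx').1 (h.lt hGx').2 hG hA hx')

/-- Interior points from which acceptance spreads to all correct neighbours. -/
def Active (G A : ℕ → ℕ → Prop) (i j : ℕ) : Prop :=
  (1 ≤ i ∧ i ≤ 8 ∧ 1 ≤ j ∧ j ≤ 8) ∧ G i j ∧ A i j ∧ ∃ x y, CoordAdj i j x y ∧ G x y ∧ A x y

theorem Spreading.accept_of_active (h : Spreading G A R) {i j x y : ℕ} (hQ : Active G A i j)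
    (hx : CoordAdj i j x y) (hG : G x y) : A x y := by
  obtain ⟨⟨h1, h2, h3, h4⟩, h5, h6, x', y', h7, h8, h9⟩ := hQ
  obtain ⟨i, rfl⟩ := Nat.exists_eq_add_of_le' h1
  obtain ⟨j, rfl⟩ := Nat.exists_eq_add_of_le' h3
  exact h.accept_of_interior (by omega) (by omega) h5 h6 h7 h8 h9 hx hG

theorem Spreading.active_of_active (h : Spreading G A R) {i j x y : ℕ} (hQ : Active G A i j)
    (hx : CoordAdj i j x y) (hG : G x y) (hi : 1 ≤ x ∧ x ≤ 8 ∧ 1 ≤ y ∧ y ≤ 8) : Active G A x y :=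
  ⟨hi, hG, h.accept_of_active hQ hx hG, i, j, by unfold CoordAdj at hx ⊢; omega, hQ.2.1, hQ.2.2.1⟩

theorem Spreading.active_row (h : Spreading G A R) {i j : ℕ}
    (hG : ∀ y, 1 ≤ y → y ≤ 8 → G i y) (hQ : Active G A i j) {y : ℕ} (h1 : 1 ≤ y) (h8 : y ≤ 8) :
    Active G A i y := by
  have hi := hQ.1
  refine (iff_of_iff_succ (P := fun y => Active G A i y) (lo := 1) (hi := 8) ?_ hi.2.2.1 hi.2.2.2
    h1 h8).1 hQ
  intro k hk hk'
  exact ⟨fun hk2 => h.active_of_active hk2 (by simp [CoordAdj]) (hG _ (by omega) (by omega))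
      (by omega),
    fun hk2 => h.active_of_active hk2 (by simp [CoordAdj]) (hG _ (by omega) (by omega)) (by omega)⟩

theorem Spreading.active_column (h : Spreading G A R) {i j : ℕ}
    (hG : ∀ x, 1 ≤ x → x ≤ 8 → G x j) (hQ : Active G A i j) {x : ℕ} (h1 : 1 ≤ x) (h8 : x ≤ 8) :
    Active G A x j := by
  have hi := hQ.1
  refine (iff_of_iff_succ (P := fun x => Active G A x j) (lo := 1) (hi := 8) ?_ hi.1 hi.2.1
    h1 h8).1 hQ
  intro k hk hk'
  exact ⟨fun hk2 => h.active_of_active hk2 (by simp [CoordAdj]) (hG _ (by omega) (by omega))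
      (by omega),
    fun hk2 => h.active_of_active hk2 (by simp [CoordAdj]) (hG _ (by omega) (by omega)) (by omega)⟩

/-- Activity runs along full rows and columns avoiding the bad point `(a, b)`: a row other than `a`
feeds every column other than `b`, and these feed the rest of column `b` along rows. -/
theorem Spreading.active_of_exists (h : Spreading G A R) {i j : ℕ} (hQ : Active G A i j) {x y : ℕ}
    (hG : G x y) (hx : 1 ≤ x ∧ x ≤ 8 ∧ 1 ≤ y ∧ y ≤ 8) : Active G A x y := by
  -- Without a bad point, `(0, 0)` serves as a dummy: it lies outside the interior.
  obtain ⟨a, b, hab, hgood⟩ : ∃ a b, (¬ G a b ∨ (a = 0 ∧ b = 0)) ∧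
      ∀ x y, 1 ≤ x ∧ x ≤ 8 ∧ 1 ≤ y ∧ y ≤ 8 → ¬ (x = a ∧ y = b) → G x y := by
    by_cases hall : ∃ a b, a < 10 ∧ b < 10 ∧ ¬ G a b
    · obtain ⟨a, b, ha, hb, hab⟩ := hall
      refine ⟨a, b, Or.inl hab, fun x y hxy hne => ?_⟩
      by_contra hG
      exact hne (h.uniq (by omega) (by omega) ha hb hG hab)
    · push Not at hall
      exact ⟨0, 0, Or.inr ⟨rfl, rfl⟩, fun x y hxy _ => hall x y (by omega) (by omega)⟩
  have hne : ∀ x y, 1 ≤ x → G x y → ¬ (x = a ∧ y = b) := by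
    rintro x y hx1 hG ⟨rfl, rfl⟩
    rcases hab with hab | ⟨h0, -⟩
    · exact hab hG
    · omega
  have main : ∀ i j, Active G A i j → i ≠ a → Active G A x y := by
    intro i j hQ hia
    have hrow : ∀ y, 1 ≤ y → y ≤ 8 → Active G A i y := fun y h1 h8 =>
      h.active_row (fun y h1 h8 => hgood i y ⟨hQ.1.1, hQ.1.2.1, h1, h8⟩ fun hh => hia hh.1) hQ h1 h8
    have hcol : ∀ x y, 1 ≤ x ∧ x ≤ 8 ∧ 1 ≤ y ∧ y ≤ 8 → y ≠ b → Active G A x y :=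
      fun x y hxy hyb => h.active_column (fun x h1 h8 => hgood x y ⟨h1, h8, hxy.2.2⟩
        fun hh => hyb hh.2) (hrow y hxy.2.2.1 hxy.2.2.2) hxy.1 hxy.2.1
    by_cases hyb : y = b
    · have hxa : x ≠ a := fun hxa => hne x y hx.1 hG ⟨hxa, hyb⟩
      obtain ⟨y', h1, h8, hy'⟩ : ∃ y', 1 ≤ y' ∧ y' ≤ 8 ∧ y' ≠ b := by
        by_cases hb1 : b = 1
        · exact ⟨2, by omega, by omega, by omega⟩
        · exact ⟨1, by omega, by omega, by omega⟩
      exact h.active_row (fun y h1 h8 => hgood x y ⟨hx.1, hx.2.1, h1, h8⟩ fun hh => hxa hh.1)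
        (hcol x y' ⟨hx.1, hx.2.1, h1, h8⟩ hy') hx.2.2.1 hx.2.2.2
    · exact hcol x y hx hyb
  by_cases hia : i = a
  · have hjb : j ≠ b := fun hjb => hne i j hQ.1.1 hQ.2.1 ⟨hia, hjb⟩
    obtain ⟨i', h1, h8, hi'⟩ : ∃ i', 1 ≤ i' ∧ i' ≤ 8 ∧ i' ≠ a := by
      by_cases hb1 : a = 1
      · exact ⟨2, by omega, by omega, by omega⟩
      · exact ⟨1, by omega, by omega, by omega⟩
    exact main i' j (h.active_column (fun x h1 h8 => hgood x j ⟨h1, h8, hQ.1.2.2⟩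
      fun hh => hjb hh.2) hQ h1 h8) hi'
  · exact main i j hQ hia

/-- The nearest interior coordinate. -/
def clamp (i : ℕ) : ℕ := max 1 (min i 8)

/-- `(i, j)` and the nodes between it and the interior of the grid are correct. -/
def Exposed (G : ℕ → ℕ → Prop) (i j : ℕ) : Prop :=
  G i j ∧ G (clamp i) (clamp j) ∧ G (clamp i) j ∧ G i (clamp j)

theorem Spreading.exists_active (h : Spreading G A R) {i j : ℕ} (hS : Exposed G i j) (hA : A i j)
    (hN : ∀ x y, x < 10 → y < 10 → CoordAdj i j x y → A x y) : ∃ x y, Active G A x y := by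
  obtain ⟨h1, h2, h3, h4⟩ := hS
  obtain ⟨hi, hj⟩ := h.lt h1
  by_cases hi' : i = clamp i <;> by_cases hj' : j = clamp j
  · have hint : 1 ≤ i ∧ i ≤ 8 ∧ 1 ≤ j ∧ j ≤ 8 := by unfold clamp at hi' hj'; omega
    -- Two opposite neighbours cannot both be bad.
    by_cases hG : G (i + 1) j
    · exact ⟨i, j, hint, h1, hA, i + 1, j, by simp [CoordAdj], hG,
        hN _ _ (by omega) hj (by simp [CoordAdj])⟩
    · have hadj : CoordAdj i j (i - 1) j := by unfold CoordAdj; omega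
      refine ⟨i, j, hint, h1, hA, i - 1, j, hadj, ?_, hN _ _ (by omega) hj hadj⟩
      by_contra hG'
      have := h.uniq (by omega) hj (by omega) hj hG hG'
      omega
  · have hadj : CoordAdj i j i (clamp j) := by unfold CoordAdj clamp at *; omega
    exact ⟨i, clamp j, by unfold clamp at *; omega, h4, hN _ _ hi (h.lt h4).2 hadj, i, j,
      by unfold CoordAdj at *; omega, h1, hA⟩
  · have hadj : CoordAdj i j (clamp i) j := by unfold CoordAdj clamp at *; omega
    exact ⟨clamp i, j, by unfold clamp at *; omega, h3, hN _ _ (h.lt h3).1 hj hadj, i, j,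
      by unfold CoordAdj at *; omega, h1, hA⟩
  -- Corner: its two neighbours accept directly, and one authorizes the diagonal node for the zone
  -- of the other.
  · have hu := hN _ _ (h.lt h3).1 hj (by unfold CoordAdj clamp at *; omega)
    have hv := hN _ _ hi (h.lt h4).2 (by unfold CoordAdj clamp at *; omega)
    have hr : R (clamp i) j (clamp i) (clamp j) :=
      h.auth (h.lt h3).1 hj (h.lt h2).1 (h.lt h2).2 h4 (by unfold CoordBorder clamp at *; omega)
        (by unfold CoordBorder clamp at *; omega) (by unfold CoordAdj clamp at *; omega) (Or.inl hv)
    have hd := h.accept (h.lt h2).1 (h.lt h2).2 h3 hu (by unfold CoordAdj clamp at *; omega) hr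
    exact ⟨clamp i, clamp j, by unfold clamp at *; omega, h2, hd, clamp i, j,
      by unfold CoordAdj clamp at *; omega, h3, hu⟩

theorem Spreading.accept_of_exposed (h : Spreading G A R) {a b : ℕ} (hQ : Active G A a b)
    {i j : ℕ} (hS : Exposed G i j) : A i j := by
  obtain ⟨h1, h2, h3, h4⟩ := hS
  obtain ⟨hi, hj⟩ := h.lt h1
  have hd : Active G A (clamp i) (clamp j) :=
    h.active_of_exists hQ h2 (by unfold clamp; omega)
  by_cases hi' : i = clamp i <;> by_cases hj' : j = clamp j
  · rw [← hi', ← hj'] at hd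
    exact hd.2.2.1
  · exact h.accept_of_active hd (by unfold CoordAdj clamp at *; omega) h1
  · exact h.accept_of_active hd (by unfold CoordAdj clamp at *; omega) h1
  -- The same exchange in reverse: the diagonal node reaches the two neighbours of the corner, and
  -- one authorizes the corner for the zone of the other.
  · have hu := h.accept_of_active hd (by unfold CoordAdj clamp at *; omega) h3
    have hv := h.accept_of_active hd (by unfold CoordAdj clamp at *; omega) h4
    have hr : R (clamp i) j i j :=
      h.auth (h.lt h3).1 hj hi hj h4 (by unfold CoordBorder clamp at *; omega)
        (by unfold CoordBorder clamp at *; omega) (by unfold CoordAdj clamp at *; omega) (Or.inl hv)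
    exact h.accept hi hj h3 hu (by unfold CoordAdj clamp at *; omega) hr

end Spread


/-! ### Reliable sets of the macro-node with at most one failure -/

section SingleFailure

/-- Translation to natural-number coordinates, where the geometry is linear arithmetic. -/
theorem spreading_of_execution {corr : Finset (Node N)} (huniq : ∀ x ∉ corr, ∀ y ∉ corr, x = y)
    {c : ℕ → State (Node N)} (h : IsExecution (grid N) (Set.range zone) corr c) {s : Node N}
    {m : ℕ} (hs : Reached (Set.range zone) c s m s) :
    Spreading (fun i j => ∃ (hi : i < N) (hj : j < N), ((⟨i, hi⟩, ⟨j, hj⟩) : Node N) ∈ corr)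
      (fun i j => ∃ (hi : i < N) (hj : j < N), Reached (Set.range zone) c s m (⟨i, hi⟩, ⟨j, hj⟩))
      (fun a b i j => ∃ (ha : a < N) (hb : b < N) (hi : i < N) (hj : j < N) (n : ℕ),
        Authorized (c n) (⟨i, hi⟩, ⟨j, hj⟩) s m (zone (⟨a, ha⟩, ⟨b, hb⟩))) where
  lt := fun ⟨hi, hj, _⟩ => ⟨hi, hj⟩
  uniq hi hj hi' hj' h1 h2 := by
    have := huniq (⟨_, hi⟩, ⟨_, hj⟩) (fun hx => h1 ⟨hi, hj, hx⟩) (⟨_, hi'⟩, ⟨_, hj'⟩)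
      (fun hx => h2 ⟨hi', hj', hx⟩)
    simpa using this
  auth := by
    intro a b i j i' j' ha hb hi' hj' hG hB hB' hadj hP
    obtain ⟨hi, hj, hG⟩ := hG
    refine ⟨ha, hb, hi', hj', authorized_of_adj h hG ?_ ?_ ?_ ?_⟩
    · simpa [zone, CoordBorder] using hB
    · simpa [zone, CoordBorder] using hB'
    · simpa [grid, CoordAdj] using hadj
    · rcases hP with ⟨_, _, hP⟩ | ⟨_, _, _, _, hP⟩
      · exact Or.inl hP
      · exact Or.inr hP
  accept := by
    intro a b i j hi hj hG hA hadj hR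
    obtain ⟨ha, hb, hG⟩ := hG
    obtain ⟨_, _, hA⟩ := hA
    obtain ⟨_, _, _, _, hR⟩ := hR
    refine ⟨hi, hj, reached_of_authorized h hs hG hA ?_ hR⟩
    simpa [grid, CoordAdj] using hadj

/-- The nearest interior coordinate. -/
def clampFin (i : Fin N) : Fin N := ⟨clamp i.val, by unfold clamp; simp only [N]; omega⟩

/-- The correct nodes that are not cut off from the interior of the grid. -/
def exposedNodes (corr : Finset (Node N)) : Finset (Node N) :=
  Finset.univ.filter fun x => x ∈ corr ∧ (clampFin x.1, clampFin x.2) ∈ corr ∧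
    (clampFin x.1, x.2) ∈ corr ∧ (x.1, clampFin x.2) ∈ corr

theorem isReliable_exposedNodes {corr : Finset (Node N)}
    (huniq : ∀ x ∉ corr, ∀ y ∉ corr, x = y) : IsReliableCZP corr (exposedNodes corr) := by
  refine ⟨fun x hx => (Finset.mem_filter.1 hx).2.1, fun c h s hs r hr m => ⟨?_, ?_⟩⟩
  · rintro ⟨n, hn⟩
    have hss : Reached (Set.range zone) c s m s := ⟨n, Or.inl ⟨rfl, hn⟩⟩
    have hsp := spreading_of_execution huniq h hss
    obtain ⟨-, hs1, hs2, hs3, hs4⟩ := Finset.mem_filter.1 hs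
    obtain ⟨-, hr1, hr2, hr3, hr4⟩ := Finset.mem_filter.1 hr
    obtain ⟨a, b, hab⟩ := hsp.exists_active (i := s.1.val) (j := s.2.val)
      ⟨⟨s.1.isLt, s.2.isLt, hs1⟩, ⟨(clampFin s.1).isLt, (clampFin s.2).isLt, hs2⟩,
        ⟨(clampFin s.1).isLt, s.2.isLt, hs3⟩, ⟨s.1.isLt, (clampFin s.2).isLt, hs4⟩⟩
      ⟨s.1.isLt, s.2.isLt, hss⟩
      (fun x y hx hy hadj => ⟨hx, hy, reached_of_adj_source h hs1 hss (by
        simpa [grid, CoordAdj, Fin.ext_iff] using hadj)⟩)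
    obtain ⟨_, _, hA⟩ := hsp.accept_of_exposed hab (i := r.1.val) (j := r.2.val)
      ⟨⟨r.1.isLt, r.2.isLt, hr1⟩, ⟨(clampFin r.1).isLt, (clampFin r.2).isLt, hr2⟩,
        ⟨(clampFin r.1).isLt, r.2.isLt, hr3⟩, ⟨r.1.isLt, (clampFin r.2).isLt, hr4⟩⟩
    exact hA
  · intro n hn
    refine bcast_of_accepts h ?_ (Finset.mem_filter.1 hs).2.1 n r hn
    intro q hq x hx
    by_contra hxc
    exact (Finset.mem_filter.1 hx).2.1 (huniq x hxc q hq)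

/-- The nodes of the sides, other than corners, whose only neighbour off the sides is `b`. -/
def cutOff (b : Node N) : Finset (Node N) :=
  Finset.univ.filter fun x => x ≠ b ∧ (clampFin x.1, clampFin x.2) = b ∧
    (clampFin x.1 = x.1 ∨ clampFin x.2 = x.2)

/-- When `b` is silent, `x` hears only its two neighbours along the side. They are at distance two,
so neither lies on the border of the other's zone, and `x` can accept only from the source itself.
-/
theorem eq_or_adj_of_cutOff {corr T : Finset (Node N)} (hT : IsReliableCZP corr T) {b x s : Node N}
    (hb : b ∉ corr) (hx : x ∈ cutOff b) (hxT : x ∈ T) (hsT : s ∈ T) : s = x ∨ (grid N).Adj s x := by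
  by_contra hne
  push Not at hne
  obtain ⟨hne, hadj⟩ := hne
  have hex := isExecution_silentExecution (G := grid N) (ctr := Set.range zone) (corr := corr) s 0
  -- State `0` is empty; the broadcast is present from state `1` on.
  obtain ⟨n, hn⟩ := ((hT.2 _ hex s hsT x hxT 0).1 ⟨1, rfl, rfl⟩)
  rw [accepts_zone_iff fun p q x => hex.adj_of_rcv] at hn
  rcases hn with ⟨hn, -⟩ | ⟨-, q, hq, rfl | ⟨-, q', hq', hq'x⟩⟩
  · exact hne hn.symm
  · exact hadj (hex.adj_of_rcv hq)
  · have h1 := hex.adj_of_rcv hq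
    have h2 := hex.adj_of_rcv hq'x
    have h3 : q ≠ b := fun h => hb (h ▸ mem_corr_of_rcv_silentExecution hq)
    have h4 : q' ≠ b := fun h => hb (h ▸ mem_corr_of_rcv_silentExecution hq'x)
    obtain ⟨-, h5, rfl, h6⟩ := Finset.mem_filter.1 hx
    obtain ⟨-, h7⟩ := Finset.mem_filter.1 hq'
    have hx1 := x.1.isLt
    have hx2 := x.2.isLt
    clear hq hq' hq'x hadj hne hb hx hex hT
    simp only [grid, clampFin, clamp, N, Fin.ext_iff, Prod.ext_iff, ne_eq] at *
    omega

theorem card_node : Fintype.card (Node N) = 100 := by simp [N]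

/-- `x` lies on the `i`-th side of the `N × N` grid. -/
def onSide (i : Fin 4) (x : Node N) : Bool :=
  match i with
  | 0 => decide (x.1.val = 0)
  | 1 => decide (x.1.val = N - 1)
  | 2 => decide (x.2.val = 0)
  | 3 => decide (x.2.val = N - 1)

/-- The four sides of the `N × N` grid. -/
def side (i : Fin 4) : Finset (Node N) := Finset.univ.filter fun x => onSide i x

theorem card_side (i : Fin 4) : (side i).card = 10 := by
  revert i; decide +kernel

theorem compl_exposedNodes (b : Node N) : (exposedNodes {b}ᶜ)ᶜ =
    Finset.univ.filter fun x => x = b ∨ (clampFin x.1, clampFin x.2) = b ∨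
      (clampFin x.1, x.2) = b ∨ (x.1, clampFin x.2) = b := by
  ext x
  simp only [exposedNodes, Finset.mem_compl, Finset.mem_filter, Finset.mem_univ, true_and,
    Finset.mem_singleton]
  tauto

theorem card_compl_exposedNodes_le (b : Node N) : (exposedNodes {b}ᶜ)ᶜ.card ≤ 4 := by
  rw [compl_exposedNodes]
  revert b; decide +kernel

/-- Prepares the count on one side: all but two of the lost nodes can be matched by unavoidable
losses off side `i`. In the extreme case `b = (1, 1)` the lost nodes are `b`, two cut-off nodes and
the corner. Checked by enumeration. -/
theorem card_compl_exposedNodes (b : Node N) (i : Fin 4) :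
    (exposedNodes {b}ᶜ)ᶜ.card ≤ 2 + (insert b (cutOff b) \ side i).card := by
  have h : insert b (cutOff b) \ side i = Finset.univ.filter fun x => (x = b ∨
      (x ≠ b ∧ (clampFin x.1, clampFin x.2) = b ∧ (clampFin x.1 = x.1 ∨ clampFin x.2 = x.2))) ∧
      ¬ onSide i x := by
    ext x
    simp only [cutOff, side, Finset.mem_sdiff, Finset.mem_insert, Finset.mem_filter,
      Finset.mem_univ, true_and]
  rw [compl_exposedNodes, h]
  revert b i; decide +kernel

theorem card_exposedNodes (b : Node N) : 96 ≤ (exposedNodes {b}ᶜ).card := by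
  have h1 := card_compl_exposedNodes_le b
  have h2 := Finset.card_add_card_compl (exposedNodes ({b}ᶜ : Finset (Node N)))
  rw [card_node] at h2
  omega

theorem card_eq_or_adj (x : Node N) : (Finset.univ.filter fun s : Node N => s = x ∨
    (s.1 = x.1 ∧ (s.2.val + 1 = x.2.val ∨ x.2.val + 1 = s.2.val)) ∨
    (s.2 = x.2 ∧ (s.1.val + 1 = x.1.val ∨ x.1.val + 1 = s.1.val))).card ≤ 5 := by
  revert x; decide +kernel

theorem isReliable_relCZP {M : ℕ} (corr : Finset (Node M)) : IsReliableCZP corr (relCZP corr) :=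
  (Classical.choose_spec (exists_largest_reliable corr)).1

theorem card_le_card_relCZP {M : ℕ} {corr T : Finset (Node M)} (hT : IsReliableCZP corr T) :
    T.card ≤ (relCZP corr).card :=
  (Classical.choose_spec (exists_largest_reliable corr)).2 T hT

theorem relCZP_univ : relCZP (Finset.univ : Finset (Node N)) = Finset.univ := by
  have h := card_le_card_relCZP (isReliable_exposedNodes (corr := Finset.univ) (by simp))
  have h2 : exposedNodes Finset.univ = Finset.univ := by simp [exposedNodes]
  rw [h2, Finset.card_univ] at h
  exact Finset.card_eq_iff_eq_univ _ |>.1 (le_antisymm (Finset.card_le_univ _) h)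

theorem card_relCZP_compl_singleton (b : Node N) : 96 ≤ (relCZP ({b}ᶜ : Finset (Node N))).card :=
  (card_exposedNodes b).trans (card_le_card_relCZP (isReliable_exposedNodes (by simp)))

/-- A largest reliable set `T` misses no more nodes than `exposedNodes` does, and it must miss `b`
and `cutOff b`. Those of them off side `i` use up all but two of its losses, so at least `10 - 2`
nodes of the side remain, more than `3N/4 = 7.5`. -/
theorem card_side_relCZP_compl_singleton (b : Node N) (i : Fin 4) :
    8 ≤ (relCZP {b}ᶜ ∩ side i).card := by
  set T := relCZP ({b}ᶜ : Finset (Node N)) with hTdef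
  have hT : IsReliableCZP {b}ᶜ T := isReliable_relCZP _
  have hcard : (exposedNodes {b}ᶜ).card ≤ T.card :=
    card_le_card_relCZP (isReliable_exposedNodes (by simp))
  have hsub : insert b (cutOff b) ⊆ Tᶜ := by
    intro x hx
    rw [Finset.mem_compl]
    intro hxT
    rcases Finset.mem_insert.1 hx with rfl | hx
    · have := hT.1 hxT
      simp at this
    -- If `T` contained a cut-off node `x`, it would consist of `x` and neighbours of `x` only.
    · have h1 : T.card ≤ 5 := by
        refine (Finset.card_le_card fun s hs => ?_).trans (card_eq_or_adj x)
        rw [Finset.mem_filter]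
        exact ⟨Finset.mem_univ s, eq_or_adj_of_cutOff hT (by simp) hx hxT hs⟩
      have h2 : 96 ≤ T.card := card_relCZP_compl_singleton b
      omega
  have h1 : (side i \ T).card + (insert b (cutOff b) \ side i).card ≤ Tᶜ.card := by
    rw [← Finset.card_union_of_disjoint]
    · refine Finset.card_le_card (Finset.union_subset ?_ ?_)
      · intro x hx
        simp at hx
        simp [hx.2]
      · exact Finset.sdiff_subset.trans hsub
    · exact Finset.disjoint_sdiff.mono_left Finset.sdiff_subset
  have h2 := card_compl_exposedNodes b i
  have h3 := card_side i
  have h4 := Finset.card_sdiff_add_card_inter (side i) T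
  rw [Finset.card_compl] at h1 h2
  rw [Finset.inter_comm]
  have h5 : (exposedNodes ({b}ᶜ : Finset (Node N))).card ≤ Fintype.card (Node N) :=
    Finset.card_le_univ _
  omega

theorem eq_univ_or_compl_singleton {corr : Finset (Node N)} (h : 99 ≤ corr.card) :
    corr = Finset.univ ∨ ∃ b, corr = {b}ᶜ := by
  have h1 := Finset.card_add_card_compl corr
  rw [card_node] at h1
  rcases Nat.le_one_iff_eq_zero_or_eq_one.1 (by omega : corrᶜ.card ≤ 1) with h2 | h2
  · exact Or.inl (by simpa using h2)
  · obtain ⟨b, hb⟩ := Finset.card_eq_one.1 h2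
    exact Or.inr ⟨b, by rw [← hb, compl_compl]⟩

theorem correctMacro_of_card {corr : Finset (Node N)} (h : 99 ≤ corr.card) : CorrectMacro corr := by
  have key : ∀ i, 8 ≤ (relCZP corr ∩ side i).card := by
    intro i
    rcases eq_univ_or_compl_singleton h with rfl | ⟨b, rfl⟩
    · rw [relCZP_univ, Finset.univ_inter, card_side]
      omega
    · exact card_side_relCZP_compl_singleton b i
  have h0 := key 0
  have h1 := key 1
  have h2 := key 2
  have h3 := key 3
  simp only [side, onSide, decide_eq_true_eq, Finset.inter_filter, Finset.inter_univ] at h0 h1 h2 h3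
  unfold CorrectMacro
  simp only [N] at *
  omega

theorem loss_le (corr : Finset (Node N)) :
    (100 - (relCZP corr).card : ℝ) ≤
      4 * (if corr.card = 99 then 1 else 0) + 100 * (if corr.card < 99 then 1 else 0) := by
  by_cases h : corr.card < 99
  · rw [if_pos h, if_neg (by omega)]
    have : (0 : ℝ) ≤ (relCZP corr).card := Nat.cast_nonneg _
    linarith
  · rw [if_neg h]
    rcases eq_univ_or_compl_singleton (not_lt.1 h) with rfl | ⟨b, rfl⟩
    · rw [relCZP_univ, Finset.card_univ, card_node]
      norm_num
    · have h1 : (96 : ℝ) ≤ (relCZP ({b}ᶜ : Finset (Node N))).card := by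
        exact_mod_cast card_relCZP_compl_singleton b
      rw [if_pos (by rw [Finset.card_compl, card_node, Finset.card_singleton])]
      linarith

end SingleFailure


/-! ### Recursion over the levels -/

section Recursion

theorem inMacro_injective (k : ℕ) :
    Function.Injective fun x : GNode k × Node N => inMacro x.1 x.2 := by
  rintro ⟨p, a⟩ ⟨q, b⟩ h
  have ha1 := a.1.isLt
  have ha2 := a.2.isLt
  have hb1 := b.1.isLt
  have hb2 := b.2.isLt
  simp only [inMacro, N, Prod.ext_iff, Fin.ext_iff] at h ha1 ha2 hb1 hb2 ⊢
  omega

theorem card_gnode (k : ℕ) : Fintype.card (GNode k) = 100 ^ k := by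
  simp only [Fintype.card_prod, Fintype.card_fin, ← mul_pow, N, Nat.reduceMul]

/-- `G_{k+1}` is partitioned into the macro-nodes of `G_k`. -/
noncomputable def macroEquiv (k : ℕ) : GNode k × Node N ≃ GNode (k + 1) :=
  Equiv.ofBijective (fun x => inMacro x.1 x.2)
    ((Fintype.bijective_iff_injective_and_card _).2 ⟨inMacro_injective k, by
      rw [Fintype.card_prod, card_gnode, card_gnode, card_node, pow_succ]⟩)

theorem corrIn_eq {k : ℕ} (corr : Finset (GNode (k + 1))) (p : GNode k)
    [DecidablePred fun a => macroEquiv k (p, a) ∈ corr] :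
    corrIn corr p = Finset.univ.filter fun a => macroEquiv k (p, a) ∈ corr := by
  ext a
  simp [corrIn, macroEquiv]

theorem card_Rel {k : ℕ} (corr : Finset (GNode (k + 2))) :
    (Rel (k + 2) corr).card =
      ∑ p ∈ Rel (k + 1) (corrMacro corr), (relCZP (corrIn corr p)).card := by
  rw [Rel, Finset.card_biUnion]
  · refine Finset.sum_congr rfl fun p _ => Finset.card_image_of_injective _ fun a b h => ?_
    exact (Prod.mk.inj (inMacro_injective (k + 1) (a₁ := (p, a)) (a₂ := (p, b)) h)).2
  · intro p _ q _ hpq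
    rw [Function.onFun, Finset.disjoint_left]
    intro x hx hx'
    obtain ⟨a, -, rfl⟩ := Finset.mem_image.1 hx
    obtain ⟨b, -, hb⟩ := Finset.mem_image.1 hx'
    exact hpq (Prod.mk.inj (inMacro_injective (k + 1) (a₁ := (q, b)) (a₂ := (p, a)) hb)).1.symm

/-- The expected number of nodes of an `N × N` grid outside of `Rel_CZP`. -/
noncomputable def expectedLoss (μ : ℝ) : ℝ :=
  expectation μ fun corr : Finset (Node N) => (100 - (relCZP corr).card : ℝ)

open Classical in
/-- The probability that a macro-node is correct. -/
noncomputable def macroProb (μ : ℝ) : ℝ :=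
  expectation μ fun corr : Finset (Node N) => if CorrectMacro corr then 1 else 0

theorem F_one (μ : ℝ) : F 1 μ = 1 - expectedLoss μ / 100 := by
  -- The side length is generalized because `Node (N ^ 1)` and `Node N` are different types.
  have key : ∀ M, M = N → expectation μ (fun corr : Finset (Node M) =>
      ((relCZP corr).card : ℝ) / (Fintype.card (Node M) : ℝ)) = 1 - expectedLoss μ / 100 := by
    rintro M rfl
    rw [expectedLoss, expectation_sub, expectation_const, card_node]
    simp only [div_eq_inv_mul, expectation_const_mul]
    push_cast
    ring
  exact key (N ^ 1) (pow_one N)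

/-- `Rel (k + 1) (corrMacro corr)` and the losses inside its macro-nodes are dependent. Charging the
losses of all macro-nodes, selected or not, makes linearity of expectation sufficient. -/
theorem F_add_two_ge (k : ℕ) {μ : ℝ} (h0 : 0 ≤ μ) (h1 : μ ≤ 1) :
    F (k + 1) (macroProb μ) - expectedLoss μ / 100 ≤ F (k + 2) μ := by
  classical
  have hpos : (0 : ℝ) < 100 ^ (k + 1) := by positivity
  have e1 : expectation μ (fun corr : Finset (GNode (k + 2)) =>
      ((Rel (k + 1) (corrMacro corr)).card : ℝ) / 100 ^ (k + 1)) = F (k + 1) (macroProb μ) := by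
    have h := expectation_good_blocks (macroEquiv (k + 1)) μ CorrectMacro
      (fun D => ((Rel (k + 1) D).card : ℝ) / 100 ^ (k + 1))
    simp only [← corrIn_eq] at h
    rw [F, card_gnode, macroProb]
    push_cast
    rw [← h]
    simp only [corrMacro]
  have e2 : expectation μ (fun corr : Finset (GNode (k + 2)) =>
      ((100 ^ (k + 2))⁻¹ : ℝ) * ∑ p : GNode (k + 1),
        (100 - (relCZP (corrIn corr p)).card : ℝ)) = expectedLoss μ / 100 := by
    have h : ∀ p, expectation μ (fun corr : Finset (GNode (k + 2)) =>
        (100 - (relCZP (corrIn corr p)).card : ℝ)) = expectedLoss μ := by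
      intro p
      have h := expectation_block (macroEquiv (k + 1)) μ p
        (fun C => (100 - (relCZP C).card : ℝ))
      simp only [← corrIn_eq] at h
      exact h
    rw [expectation_const_mul, expectation_sum, Finset.sum_congr rfl fun p _ => h p,
      Finset.sum_const, Finset.card_univ, card_gnode, nsmul_eq_mul, pow_succ (100 : ℝ) (k + 1)]
    push_cast
    field_simp
  rw [← e1, ← e2, ← expectation_sub, F]
  refine expectation_mono h0 h1 fun corr => ?_
  rw [card_Rel, card_gnode]
  push_cast
  have h : (∑ p ∈ Rel (k + 1) (corrMacro corr), (100 - (relCZP (corrIn corr p)).card : ℝ)) ≤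
      ∑ p : GNode (k + 1), (100 - (relCZP (corrIn corr p)).card : ℝ) := by
    refine Finset.sum_le_sum_of_subset_of_nonneg (Finset.subset_univ _) fun p _ _ => ?_
    have := Finset.card_le_univ (relCZP (corrIn corr p))
    rw [card_node] at this
    rw [sub_nonneg]
    exact_mod_cast this
  rw [Finset.sum_sub_distrib, Finset.sum_const, nsmul_eq_mul] at h
  rw [pow_succ (100 : ℝ) (k + 1), le_div_iff₀ (by positivity)]
  refine le_trans (le_of_eq ?_) (sub_le_comm.1 h)
  field_simp

theorem expectedLoss_le {μ : ℝ} (h0 : 0 ≤ μ) (h1 : μ ≤ 1) :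
    expectedLoss μ ≤ 400 * (1 - μ) + 100 * (99 ^ 2 * (1 - μ) ^ 2) := by
  have ha := expectation_one_failure (V := Node N) (n := 99) card_node h0 h1
  have hb := expectation_two_failures (V := Node N) (n := 99) card_node h0 h1
  have h := expectation_mono h0 h1 loss_le
  rw [expectation_add, expectation_const_mul, expectation_const_mul] at h
  push_cast at ha hb
  rw [expectedLoss]
  linarith

theorem one_sub_macroProb_le {μ : ℝ} (h0 : 0 ≤ μ) (h1 : μ ≤ 1) :
    1 - macroProb μ ≤ 99 ^ 2 * (1 - μ) ^ 2 := by
  classical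
  have hb := expectation_two_failures (V := Node N) (n := 99) card_node h0 h1
  push_cast at hb
  refine le_trans ?_ hb
  rw [macroProb, ← expectation_const (V := Node N) μ 1, ← expectation_sub, expectation_const]
  refine expectation_mono h0 h1 fun corr => ?_
  by_cases h : corr.card < 99
  · rw [if_pos h]
    split_ifs <;> norm_num
  · rw [if_pos (correctMacro_of_card (not_lt.1 h)), if_neg h]
    norm_num

theorem macroProb_le_one {μ : ℝ} (h0 : 0 ≤ μ) (h1 : μ ≤ 1) : macroProb μ ≤ 1 := by
  refine (expectation_mono h0 h1 fun corr => ?_).trans_eq (expectation_const (V := Node N) μ 1)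
  split_ifs <;> norm_num

/-- The bound is proved for all `μ` in the range at once, since the induction hypothesis is used at
`macroProb μ`. The constant `5` closes the induction: with `ε = 9801 / 100000 < 1 / 10`, the step
needs `5 * ε + 4 + ε ≤ 5`. -/
theorem one_sub_F_le (k : ℕ) : ∀ μ : ℝ, 1 - (10 : ℝ)⁻¹ ^ 5 ≤ μ → μ ≤ 1 →
    1 - F (k + 1) μ ≤ 5 * (1 - μ) := by
  induction k with
  | zero =>
    intro μ hμ h1
    norm_num at hμ
    have h := expectedLoss_le (by linarith) h1
    rw [F_one]
    nlinarith
  | succ k ih =>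
    intro μ hμ h1
    have hμ' := hμ
    norm_num at hμ'
    have h0 : 0 ≤ μ := by linarith
    have h := expectedLoss_le h0 h1
    have hm := one_sub_macroProb_le h0 h1
    have hq : (1 - μ) ^ 2 ≤ 1 / 100000 * (1 - μ) := by nlinarith
    have hF := ih (macroProb μ) (by norm_num; linarith) (macroProb_le_one h0 h1)
    have hS := F_add_two_ge k h0 h1
    linarith

end Recursion

end ByzantineGrid

theorem mainTheorem3 (k : ℕ) (hk : 1 ≤ k) (μ : ℝ) (hμ : 1 - (10 : ℝ)⁻¹ ^ 5 ≤ μ) (hμ1 : μ ≤ 1) :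
    1 - (10 : ℝ)⁻¹ ^ 4 ≤ ByzantineGrid.F k μ := by
  obtain ⟨k, rfl⟩ := Nat.exists_eq_add_of_le' hk
  have h := ByzantineGrid.one_sub_F_le k μ hμ hμ1
  norm_num at hμ ⊢
  linarith
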